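/- All rings are commutative with unit. For a ring $A$, $\mathrm{Min}(A)\subseteq\mathrm{Spec}(A)$ is the set of minimal prime ideals; $V(I)$ is the set of primes containing $I$. The flat topology on $\mathrm{Spec}(A)$ is the topology having the sets $V(f)$, $f\in A$, as a sub-basis of open sets. $A$ is an mp-ring if every prime ideal of $A$ contains a unique minimal prime ideal. An ideal is regular if it is generated by a set of idempotents of $A$; a max-regular ideal is a maximal element (for inclusion) of the set of proper regular ideals. An ideal $I$ is pure if the canonical map $A\to A/I$ is flat. A system of equations over $A$ is a finite family $f_i(x_1,\dots,x_n)=0$, $1\le i\le d$, with $f_i\in A[x_1,\dots,x_n]$. Idempotents of $A$ can be lifted along a ring map $\varphi:A\to B$ if every idempotent of $B$ is the image of an idempotent of $A$. Theorem. For a reduced ring $A$ the following statements are equivalent. (i) $A$ is purified, i.e. for any two distinct minimal primes $\mathfrak p,\mathfrak q$ of $A$ there is an idempotent $e\in A$ with $e\in\mathfrak p$ and $1-e\in\mathfrak q$. (ii) $A$ is an mp-ring and $\mathrm{Min}(A)$ is totally disconnected with respect to the flat topology. (iii) Every minimal prime ideal of $A$ is a regular ideal. (iv) The connected components of $\mathrm{Spec}(A)$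 (with the Zariski topology) are precisely the sets $V(\mathfrak p)$ with $\mathfrak p$ a minimal prime ideal of $A$. (v) If a system of equations over $A$ has a solution in each ring $A/\mathfrak p$ with $\mathfrak p$ a minimal prime of $A$, then it has a solution in $A$. (vi) The idempotents of $A$ can be lifted along the canonical map $A\to S^{-1}A$ for each multiplicative subset $S$ of $A$. (vii) The sets $V(e)\cap\mathrm{Min}(A)$ with $e\in A$ idempotent form a basis for the topology on $\mathrm{Min}(A)$ induced by the flat topology. (viii) $A$ is an mp-ring and every pure ideal of $A$ is a regular ideal. (ix) The max-regular ideals of $A$ are precisely the minimal prime ideals of $A$. (x) For each $f\in A$, the annihilator $\mathrm{Ann}(f)$ is a regular ideal of $A$. (xi) If $fg=0$ with $f,g\in A$, then there is an idempotent $e\in A$ such that $f=fe$ and $g=g(1-e)$. -/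

import Mathlib

/-- A commutative ring is purified if any two distinct minimal primes `p`, `q` are separated by an
idempotent `e`, in the sense that `e ∈ p` and `1 - e ∈ q`. -/
def IsPurifiedRing (A : Type*) [CommRing A] : Prop :=
  ∀ p ∈ minimalPrimes A, ∀ q ∈ minimalPrimes A, p ≠ q →
    ∃ e : A, IsIdempotentElem e ∧ e ∈ p ∧ 1 - e ∈ q

/-- An mp-ring: every prime ideal contains a unique minimal prime ideal. -/
def IsMpRing (A : Type*) [CommRing A] : Prop :=
  ∀ P : Ideal A, P.IsPrime → ∃! p : Ideal A, p ∈ minimalPrimes A ∧ p ≤ P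

/-- An ideal is regular if it is generated by a set of idempotents. -/
def IsRegularIdeal {A : Type*} [CommRing A] (I : Ideal A) : Prop :=
  ∃ E : Set A, (∀ e ∈ E, IsIdempotentElem e) ∧ I = Ideal.span E

/-- A max-regular ideal: a maximal element, for inclusion, of the set of proper regular ideals. -/
def IsMaxRegularIdeal {A : Type*} [CommRing A] (M : Ideal A) : Prop :=
  Maximal (fun I : Ideal A => I ≠ ⊤ ∧ IsRegularIdeal I) M

/-- The flat (inverse) topology on the prime spectrum: the sets `V(f)` with `f ∈ A` form a
sub-basis of open sets. -/
abbrev flatTopology (A : Type*) [CommRing A] : TopologicalSpace (PrimeSpectrum A) :=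
  TopologicalSpace.generateFrom
    {U | ∃ f : A, U = PrimeSpectrum.zeroLocus {f}}

/-- `Min(A)`, as a subset of the prime spectrum. -/
def minSpec (A : Type*) [CommRing A] : Set (PrimeSpectrum A) :=
  {p | p.asIdeal ∈ minimalPrimes A}

/-- The topology on `Min(A)` induced by the flat topology. It is not an instance: the instance on
the subtype is the topology induced by the Zariski topology. -/
abbrev minFlatTopology (A : Type*) [CommRing A] : TopologicalSpace (minSpec A) :=
  TopologicalSpace.induced Subtype.val (flatTopology A)

/-- The system `f i = 0` of polynomial equations over `A` has a solution in the `A`-algebra `B`. -/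
def SystemHasSolution {A : Type*} [CommRing A] {n d : ℕ}
    (f : Fin d → MvPolynomial (Fin n) A) (B : Type*) [CommRing B] [Algebra A B] : Prop :=
  ∃ c : Fin n → B, ∀ i, MvPolynomial.aeval c (f i) = 0

/-- The idempotents of `A` can be lifted along `φ`. -/
def IdempotentsLiftAlong {A B : Type*} [CommRing A] [CommRing B] (φ : A →+* B) : Prop :=
  ∀ e : B, IsIdempotentElem e → ∃ e' : A, IsIdempotentElem e' ∧ φ e' = e

/-! The join `e + f - e * f` of two idempotents satisfies `1 - (e + f - e * f) = (1 - e) * (1 - f)`,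
so membership of `x` in a regular ideal is witnessed by a single idempotent `e` of that ideal with
`x = x * e` (`IsRegularIdeal.exists_eq_mul`). Statement (iii) is the hub.

Purified gives (iii): in a reduced ring a regular ideal is radical, and the largest regular ideal
inside a minimal prime `p` lies in no prime above another minimal prime, so it is `p`. From (iii), a
solution modulo `p` becomes a solution on the piece cut out by an idempotent outside `p`; these
pieces cover the spectrum and the solutions glue, whence (v). Statement (xi) is such a system,
solvable modulo every prime; it yields (vi), (viii) and (x), each of which leads back to (i) or
(iii).

The regular part of a prime is max-regular and cuts out a connected set, which settles (ix) and
(iv). For (ii), `Min(A)` is always compact in the flat topology and is Hausdorff for an mp-ring;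
total disconnectedness then provides clopen sets, and comaximality with reducedness turns them into
idempotents. -/

theorem IsIdempotentElem.add_sub_mul_self {A : Type*} [CommRing A] {e f : A}
    (he : IsIdempotentElem e) (hf : IsIdempotentElem f) : IsIdempotentElem (e + f - e * f) := by
  unfold IsIdempotentElem at *
  grind

theorem Ideal.mem_or_one_sub_mem_of_isIdempotentElem {A : Type*} [CommRing A] {p : Ideal A}
    (hp : p.IsPrime) {e : A} (he : IsIdempotentElem e) : e ∈ p ∨ 1 - e ∈ p := by
  apply hp.mem_or_mem
  have : e * (1 - e) = 0 := by rw [mul_sub, mul_one, he.eq, sub_self]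
  rw [this]
  exact p.zero_mem

theorem Ideal.not_mem_and_one_sub_mem {A : Type*} [CommRing A] {p : Ideal A}
    (hp : p.IsPrime) {e : A} (h₁ : e ∈ p) (h₂ : 1 - e ∈ p) : False := by
  have := p.add_mem h₁ h₂
  rw [add_sub_cancel] at this
  exact hp.ne_top ((Ideal.eq_top_iff_one p).2 this)

theorem Ideal.exists_mem_minimalPrimes_le {A : Type*} [CommRing A] (P : Ideal A)
    (hP : P.IsPrime) : ∃ p ∈ minimalPrimes A, p ≤ P :=
  Ideal.exists_minimalPrimes_le bot_le

theorem Ideal.eq_of_le_minimalPrimes {A : Type*} [CommRing A] {p q : Ideal A}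
    (hp : p ∈ minimalPrimes A) (hq : q.IsPrime) (h : q ≤ p) : q = p :=
  le_antisymm h (hp.2 ⟨hq, bot_le⟩ h)

/-- In a reduced ring, an element of all the minimal primes below a prime `P` vanishes in the
localization at `P`. -/
theorem Ideal.exists_notMem_mul_eq_zero {A : Type*} [CommRing A] [IsReduced A]
    {P : Ideal A} (hP : P.IsPrime) {x : A} (hx : ∀ p ∈ minimalPrimes A, p ≤ P → x ∈ p) :
    ∃ y ∉ P, x * y = 0 := by
  by_contra! H
  -- The multiplicative set generated by `x` and the complement of `P` avoids `0`, because `A` is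
  -- reduced. A prime avoiding it lies inside `P` and omits `x`, and so does any minimal prime
  -- below.
  have hd : Disjoint ((⊥ : Ideal A) : Set A)
      ((P.primeCompl ⊔ Submonoid.powers x : Submonoid A) : Set A) := by
    rw [Set.disjoint_left]
    rintro z hz hz'
    obtain rfl : z = 0 := hz
    obtain ⟨s, hs, t, ⟨n, rfl⟩, h⟩ := Submonoid.mem_sup.1 hz'
    refine H s hs (eq_zero_of_pow_eq_zero (n := n + 1) ?_)
    rw [mul_pow, pow_succ, pow_succ]
    linear_combination x * s ^ n * h
  obtain ⟨Q, hQ, -, hQd⟩ := Ideal.exists_le_prime_disjoint _ _ hd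
  rw [Set.disjoint_left] at hQd
  have hle : Q ≤ P := fun z hz => by
    by_contra hzp
    exact hQd hz (Submonoid.mem_sup_left hzp)
  obtain ⟨q, hq, hqQ⟩ := Ideal.exists_mem_minimalPrimes_le Q hQ
  exact hQd (hqQ (hx q hq (hqQ.trans hle))) (Submonoid.mem_sup_right (Submonoid.mem_powers x))

theorem Ideal.exists_notMem_mul_eq_zero_of_mem_minimalPrimes {A : Type*} [CommRing A] [IsReduced A]
    {p : Ideal A} (hp : p ∈ minimalPrimes A) {x : A} (hx : x ∈ p) : ∃ y ∉ p, x * y = 0 :=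
  Ideal.exists_notMem_mul_eq_zero hp.1.1 fun _ hq hle =>
    Ideal.eq_of_le_minimalPrimes hp hq.1.1 hle ▸ hx

/-! ### Regular ideals and regular parts -/

theorem IsRegularIdeal.exists_eq_mul {A : Type*} [CommRing A] {I : Ideal A}
    (hI : IsRegularIdeal I) {x : A} (hx : x ∈ I) :
    ∃ e ∈ I, IsIdempotentElem e ∧ x = x * e := by
  obtain ⟨E, hE, rfl⟩ := hI
  induction hx using Submodule.span_induction with
  | mem x h => exact ⟨x, Ideal.subset_span h, hE x h, (hE x h).symm⟩
  | zero => exact ⟨0, Ideal.zero_mem _, .zero, by simp⟩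
  | add x y _ _ hx hy =>
    obtain ⟨e, he, hei, hxe⟩ := hx
    obtain ⟨f, hf, hfi, hyf⟩ := hy
    refine ⟨e + f - e * f, Ideal.sub_mem _ (Ideal.add_mem _ he hf) (Ideal.mul_mem_left _ _ hf),
      hei.add_sub_mul_self hfi, ?_⟩
    linear_combination (1 - f) * hxe + (1 - e) * hyf
  | smul a x _ hx =>
    obtain ⟨e, he, hei, hxe⟩ := hx
    refine ⟨e, he, hei, ?_⟩
    rw [smul_eq_mul, mul_assoc, ← hxe]

theorem IsRegularIdeal.of_exists_eq_mul {A : Type*} [CommRing A] {I : Ideal A}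
    (h : ∀ x ∈ I, ∃ e ∈ I, IsIdempotentElem e ∧ x = x * e) : IsRegularIdeal I := by
  refine ⟨{e | e ∈ I ∧ IsIdempotentElem e}, fun e he => he.2, le_antisymm ?_ ?_⟩
  · intro x hx
    obtain ⟨e, he, hei, hxe⟩ := h x hx
    rw [hxe]
    exact Ideal.mul_mem_left _ _ (Ideal.subset_span ⟨he, hei⟩)
  · exact Ideal.span_le.2 fun e he => he.1

theorem IsRegularIdeal.exists_forall_eq_mul {A : Type*} [CommRing A] {I : Ideal A}
    (hI : IsRegularIdeal I) {ι : Type*} (s : Finset ι) (x : ι → A) (hx : ∀ i, x i ∈ I) :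
    ∃ e ∈ I, IsIdempotentElem e ∧ ∀ i ∈ s, x i = x i * e := by
  classical
  induction s using Finset.induction_on with
  | empty => exact ⟨0, I.zero_mem, .zero, by simp⟩
  | insert j s _ ih =>
    obtain ⟨e, he, hei, hxe⟩ := ih
    obtain ⟨f, hf, hfi, hxf⟩ := hI.exists_eq_mul (hx j)
    refine ⟨e + f - e * f, I.sub_mem (I.add_mem he hf) (I.mul_mem_left _ hf),
      hei.add_sub_mul_self hfi, ?_⟩
    intro i hi
    rcases Finset.mem_insert.1 hi with rfl | hi
    · linear_combination (1 - e) * hxf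
    · linear_combination (1 - f) * hxe i hi

/-- The largest regular ideal contained in an ideal. -/
def Ideal.regularPart {A : Type*} [CommRing A] (I : Ideal A) : Ideal A :=
  Ideal.span {e | e ∈ I ∧ IsIdempotentElem e}

theorem Ideal.isRegularIdeal_regularPart {A : Type*} [CommRing A] (I : Ideal A) :
    IsRegularIdeal I.regularPart :=
  ⟨_, fun _ he => he.2, rfl⟩

theorem Ideal.regularPart_le {A : Type*} [CommRing A] (I : Ideal A) : I.regularPart ≤ I :=
  Ideal.span_le.2 fun _ he => he.1

theorem Ideal.mem_regularPart {A : Type*} [CommRing A] {I : Ideal A} {e : A} (he : e ∈ I)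
    (hei : IsIdempotentElem e) : e ∈ I.regularPart :=
  Ideal.subset_span ⟨he, hei⟩

theorem IsRegularIdeal.isRadical {A : Type*} [CommRing A] [IsReduced A] {I : Ideal A}
    (hI : IsRegularIdeal I) : I.IsRadical := by
  rintro x ⟨n, hn⟩
  obtain ⟨e, he, hei, hxe⟩ := hI.exists_eq_mul hn
  have h : x * (1 - e) = 0 := by
    refine eq_zero_of_pow_eq_zero (n := n + 1) ?_
    rw [mul_pow, pow_succ, hei.one_sub.pow_succ_eq]
    linear_combination x * hxe
  have : x = x * e := by linear_combination h
  rw [this]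
  exact I.mul_mem_left _ he

/-- A proper regular ideal cannot be strictly larger than the regular part of a prime ideal. -/
theorem IsRegularIdeal.le_regularPart {A : Type*} [CommRing A] {K P : Ideal A}
    (hK : IsRegularIdeal K) (hP : P.IsPrime) (hne : K ≠ ⊤) (h : P.regularPart ≤ K) :
    K ≤ P.regularPart := by
  intro x hx
  obtain ⟨e, he, hei, hxe⟩ := hK.exists_eq_mul hx
  rcases Ideal.mem_or_one_sub_mem_of_isIdempotentElem hP hei with h' | h'
  · rw [hxe]
    exact Ideal.mul_mem_left _ _ (Ideal.mem_regularPart h' hei)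
  · refine (hne ((Ideal.eq_top_iff_one _).2 ?_)).elim
    have := K.add_mem he (h (Ideal.mem_regularPart h' hei.one_sub))
    rwa [add_sub_cancel] at this

theorem Ideal.regularPart_ne_top {A : Type*} [CommRing A] {P : Ideal A} (hP : P.IsPrime) :
    P.regularPart ≠ ⊤ :=
  fun h => hP.ne_top (top_le_iff.1 (h ▸ P.regularPart_le))

theorem Ideal.isMaxRegularIdeal_regularPart {A : Type*} [CommRing A] {P : Ideal A}
    (hP : P.IsPrime) : IsMaxRegularIdeal P.regularPart :=
  ⟨⟨Ideal.regularPart_ne_top hP, P.isRegularIdeal_regularPart⟩,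
    fun _ hK h => hK.2.le_regularPart hP hK.1 h⟩

theorem IsMaxRegularIdeal.eq_regularPart {A : Type*} [CommRing A] {M P : Ideal A}
    (hM : IsMaxRegularIdeal M) (hP : P.IsPrime) (h : M ≤ P) : M = P.regularPart := by
  refine hM.eq_of_le ⟨Ideal.regularPart_ne_top hP, P.isRegularIdeal_regularPart⟩ ?_
  intro x hx
  obtain ⟨e, he, hei, hxe⟩ := hM.1.2.exists_eq_mul hx
  rw [hxe]
  exact Ideal.mul_mem_left _ _ (Ideal.mem_regularPart (h he) hei)

/-- The regular part of a prime ideal cuts out a connected closed subset of the spectrum. -/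
theorem Ideal.isPreconnected_zeroLocus_regularPart {A : Type*} [CommRing A] {P : Ideal A}
    (hP : P.IsPrime) : IsPreconnected (PrimeSpectrum.zeroLocus (P.regularPart : Set A)) := by
  have hsurj : Function.Surjective (Ideal.Quotient.mk P.regularPart) := Ideal.Quotient.mk_surjective
  have hr := range_comap_of_surjective _ (Ideal.Quotient.mk P.regularPart) hsurj
  rw [Ideal.mk_ker] at hr
  rw [← hr]
  have : PreconnectedSpace (PrimeSpectrum (A ⧸ P.regularPart)) := by
    rw [preconnectedSpace_iff_clopen]
    intro s hs
    obtain ⟨e, he, rfl⟩ := PrimeSpectrum.isClopen_iff_zeroLocus.1 hs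
    obtain ⟨a, rfl⟩ := hsurj e
    have ha : a * a - a ∈ P.regularPart := by
      rw [← Ideal.Quotient.eq, map_mul]
      exact he
    obtain ⟨f, hf, hfi, haf⟩ := P.isRegularIdeal_regularPart.exists_eq_mul ha
    -- Idempotents lift modulo a regular ideal: `f` absorbs the defect `a * a - a`, so cutting `a`
    -- down by `1 - f` makes it idempotent without changing its class.
    have hi : IsIdempotentElem (a * (1 - f)) := by
      unfold IsIdempotentElem at *
      grind
    have hmk : Ideal.Quotient.mk P.regularPart (a * (1 - f)) = Ideal.Quotient.mk _ a := by
      rw [Ideal.Quotient.eq]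
      have : a * (1 - f) - a = -a * f := by ring
      rw [this]
      exact Ideal.mul_mem_left _ _ hf
    rcases Ideal.mem_or_one_sub_mem_of_isIdempotentElem hP hi with h | h
    · right
      have := Ideal.Quotient.eq_zero_iff_mem.2 (Ideal.mem_regularPart h hi)
      rw [← hmk, this]
      simp
    · left
      have := Ideal.Quotient.eq_zero_iff_mem.2 (Ideal.mem_regularPart h hi.one_sub)
      rw [map_sub, map_one, hmk, sub_eq_zero] at this
      rw [← this]
      simp
  exact isPreconnected_range (PrimeSpectrum.continuous_comap _)

/-! ### Purified rings and regular minimal primes -/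

/-- The regular part is radical, hence the intersection of the primes containing it. Such a prime
cannot lie above a minimal prime `q ≠ p`, since the idempotent separating `p` from `q` would put
both `e` and `1 - e` in it. -/
theorem IsPurifiedRing.isRegularIdeal {A : Type*} [CommRing A] [IsReduced A]
    (h : IsPurifiedRing A) {p : Ideal A} (hp : p ∈ minimalPrimes A) : IsRegularIdeal p := by
  suffices p ≤ p.regularPart by
    rw [le_antisymm this p.regularPart_le]
    exact p.isRegularIdeal_regularPart
  rw [← p.isRegularIdeal_regularPart.isRadical.radical, Ideal.radical_eq_sInf, le_sInf_iff]
  rintro Q ⟨hle, hQ⟩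
  obtain ⟨q, hq, hqQ⟩ := Ideal.exists_mem_minimalPrimes_le Q hQ
  by_cases hpq : p = q
  · exact hpq ▸ hqQ
  obtain ⟨e, he, hep, heq⟩ := h p hp q hq hpq
  exact (Ideal.not_mem_and_one_sub_mem hQ (hle (Ideal.mem_regularPart hep he)) (hqQ heq)).elim

theorem isPurifiedRing_of_isRegularIdeal {A : Type*} [CommRing A]
    (h : ∀ p ∈ minimalPrimes A, IsRegularIdeal p) : IsPurifiedRing A := by
  intro p hp q hq hpq
  have hnle : ¬ p ≤ q := fun hle => hpq (Ideal.eq_of_le_minimalPrimes hq hp.1.1 hle)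
  obtain ⟨x, hx, hxq⟩ := Set.not_subset.1 hnle
  obtain ⟨e, he, hei, hxe⟩ := (h p hp).exists_eq_mul hx
  refine ⟨e, hei, he, (Ideal.mem_or_one_sub_mem_of_isIdempotentElem hq.1.1 hei).resolve_left ?_⟩
  intro heq
  apply hxq
  rw [hxe]
  exact q.mul_mem_left _ heq

/-! ### Systems of equations and annihilators -/

theorem MvPolynomial.aeval_quotient_mk {A : Type*} [CommRing A] {σ : Type*} (I : Ideal A)
    (c : σ → A) (f : MvPolynomial σ A) :
    MvPolynomial.aeval (fun i => Ideal.Quotient.mk I (c i)) f =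
      Ideal.Quotient.mk I (MvPolynomial.aeval c f) :=
  MvPolynomial.aeval_algebraMap_apply (A ⧸ I) c f

theorem MvPolynomial.mul_aeval_congr {A : Type*} [CommRing A] {σ : Type*} {e : A} {c d : σ → A}
    (h : ∀ i, e * c i = e * d i) (f : MvPolynomial σ A) :
    e * MvPolynomial.aeval c f = e * MvPolynomial.aeval d f := by
  induction f using MvPolynomial.induction_on with
  | C a => simp
  | add p q hp hq => simp only [map_add, mul_add, hp, hq]
  | mul_X p i hp =>
    simp only [map_mul, MvPolynomial.aeval_X]
    linear_combination c i * hp + MvPolynomial.aeval d p * h i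

/-- Local solutions of a system over the residue rings at the minimal primes glue along
idempotents. -/
theorem systemHasSolution_of_forall_minimalPrimes {A : Type*} [CommRing A]
    (h : ∀ p ∈ minimalPrimes A, IsRegularIdeal p) {n d : ℕ} (f : Fin d → MvPolynomial (Fin n) A)
    (hf : ∀ p ∈ minimalPrimes A, SystemHasSolution f (A ⧸ p)) : SystemHasSolution f A := by
  -- The idempotents on which the system is solvable. They are closed under joins: use `c` where `g
  -- = 1` and `b` elsewhere.
  let E : Set A := {e | IsIdempotentElem e ∧
    ∃ c : Fin n → A, ∀ i, e * MvPolynomial.aeval c (f i) = 0}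
  have hE : ∀ e ∈ Ideal.span E, ∃ g ∈ E, e = e * g := by
    intro e he
    induction he using Submodule.span_induction with
    | mem x hx => exact ⟨x, hx, hx.1.symm⟩
    | zero => exact ⟨0, ⟨.zero, 0, by simp⟩, by simp⟩
    | smul a x _ hx =>
      obtain ⟨g, hg, hxg⟩ := hx
      exact ⟨g, hg, by rw [smul_eq_mul, mul_assoc, ← hxg]⟩
    | add x y _ _ hx hy =>
      obtain ⟨g, ⟨hg, c, hc⟩, hxg⟩ := hx
      obtain ⟨k, ⟨hk, b, hb⟩, hyk⟩ := hy
      refine ⟨g + k - g * k, ⟨hg.add_sub_mul_self hk,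
        fun i => g * c i + (1 - g) * b i, fun i => ?_⟩, ?_⟩
      · have h₁ := MvPolynomial.mul_aeval_congr (e := g)
          (c := fun i => g * c i + (1 - g) * b i) (d := c) (fun i => by
            linear_combination (c i - b i) * hg.eq) (f i)
        have h₂ := MvPolynomial.mul_aeval_congr (e := 1 - g)
          (c := fun i => g * c i + (1 - g) * b i) (d := b) (fun i => by
            linear_combination (b i - c i) * hg.eq) (f i)
        linear_combination h₁ + hc i + k * h₂ + (1 - g) * hb i
      · linear_combination (1 - k) * hxg + (1 - g) * hyk
  have htop : Ideal.span E = ⊤ := by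
    by_contra hne
    obtain ⟨P, hP, hEP⟩ := Ideal.exists_le_maximal _ hne
    obtain ⟨p, hp, hpP⟩ := Ideal.exists_mem_minimalPrimes_le P hP.isPrime
    obtain ⟨c, hc⟩ := hf p hp
    -- Lift the solution modulo `p`. The finitely many values of the equations lie in `p`, so one
    -- idempotent `e ∈ p` fixes them all, and `b` solves the system on `1 - e`.
    choose b hb using fun i => Ideal.Quotient.mk_surjective (c i)
    obtain rfl : (fun i => Ideal.Quotient.mk p (b i)) = c := funext hb
    simp only [MvPolynomial.aeval_quotient_mk, Ideal.Quotient.eq_zero_iff_mem] at hc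
    obtain ⟨e, he, hei, hce⟩ := (h p hp).exists_forall_eq_mul Finset.univ _ hc
    refine Ideal.not_mem_and_one_sub_mem hP.isPrime (hpP he)
      (hEP (Ideal.subset_span ⟨hei.one_sub, b, fun i => ?_⟩))
    linear_combination hce i (Finset.mem_univ i)
  obtain ⟨g, ⟨-, c, hc⟩, hg⟩ := hE 1 ((Ideal.eq_top_iff_one _).1 htop)
  refine ⟨c, fun i => ?_⟩
  have := hc i
  rwa [show g = 1 by rw [hg, one_mul, ← one_mul g, ← hg], one_mul] at this

/-- The required `e` is the unknown of a system of three equations. Modulo a prime, `f` or `g`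
vanishes, and the constant `0` or `1` respectively is a solution. -/
theorem exists_isIdempotentElem_of_systemHasSolution {A : Type*} [CommRing A]
    (h : ∀ (n d : ℕ) (f : Fin d → MvPolynomial (Fin n) A),
      (∀ p ∈ minimalPrimes A, SystemHasSolution f (A ⧸ p)) → SystemHasSolution f A)
    (f g : A) (hfg : f * g = 0) :
    ∃ e : A, IsIdempotentElem e ∧ f = f * e ∧ g = g * (1 - e) := by
  let X : MvPolynomial (Fin 1) A := MvPolynomial.X 0
  let F : Fin 3 → MvPolynomial (Fin 1) A :=
    ![X * X - X, .C f - .C f * X, .C g - .C g * (1 - X)]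
  obtain ⟨c, hc⟩ := h 1 3 F fun p hp => by
    rcases hp.1.1.mem_or_mem (hfg ▸ p.zero_mem : f * g ∈ p) with hm | hm
    · refine ⟨fun _ => 0, fun i => ?_⟩
      have := Ideal.Quotient.eq_zero_iff_mem.2 hm
      fin_cases i <;> simp [F, X, this]
    · refine ⟨fun _ => 1, fun i => ?_⟩
      have := Ideal.Quotient.eq_zero_iff_mem.2 hm
      fin_cases i <;> simp [F, X, this]
  have h₀ := hc 0
  have h₁ := hc 1
  have h₂ := hc 2
  simp only [F, X, Matrix.cons_val, map_sub, map_mul, MvPolynomial.aeval_X, MvPolynomial.aeval_C,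
    map_one, Algebra.algebraMap_self, RingHom.id_apply] at h₀ h₁ h₂
  exact ⟨c 0, sub_eq_zero.1 h₀, sub_eq_zero.1 h₁, sub_eq_zero.1 h₂⟩

theorem isRegularIdeal_annihilator {A : Type*} [CommRing A]
    (h : ∀ f g : A, f * g = 0 → ∃ e : A, IsIdempotentElem e ∧ f = f * e ∧ g = g * (1 - e))
    (f : A) : IsRegularIdeal (Ideal.span {f}).annihilator := by
  refine .of_exists_eq_mul fun x hx => ?_
  rw [Submodule.mem_annihilator_span_singleton, smul_eq_mul, mul_comm] at hx
  obtain ⟨e, he, hf, hg⟩ := h f x hx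
  refine ⟨1 - e, ?_, he.one_sub, hg⟩
  rw [Submodule.mem_annihilator_span_singleton, smul_eq_mul]
  linear_combination hf

/-- An `x ∈ p` is killed by some `y ∉ p`. The idempotent of `Ann(y)` that fixes `x` kills `y`, so it
lies in `p`. -/
theorem isRegularIdeal_of_annihilator {A : Type*} [CommRing A] [IsReduced A]
    (h : ∀ f : A, IsRegularIdeal (Ideal.span {f}).annihilator) {p : Ideal A}
    (hp : p ∈ minimalPrimes A) : IsRegularIdeal p := by
  refine .of_exists_eq_mul fun x hx => ?_
  obtain ⟨y, hy, hxy⟩ := Ideal.exists_notMem_mul_eq_zero_of_mem_minimalPrimes hp hx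
  obtain ⟨e, he, hei, hxe⟩ := (h y).exists_eq_mul (x := x)
    (by rwa [Submodule.mem_annihilator_span_singleton, smul_eq_mul])
  rw [Submodule.mem_annihilator_span_singleton, smul_eq_mul] at he
  exact ⟨e, (hp.1.1.mem_or_mem (he ▸ p.zero_mem : e * y ∈ p)).resolve_right hy, hei, hxe⟩

/-! ### Lifting idempotents to localizations -/

/-- If `x = a / s` is idempotent, then `t * a * (s - a) = 0` for some `t ∈ S`. Splitting `t * a`
from `t * (s - a)` by `e` gives `x = x * e` and `(1 - x) * e = 0` in the localization. -/
theorem idempotentsLiftAlong_localization {A : Type*} [CommRing A]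
    (h : ∀ f g : A, f * g = 0 → ∃ e : A, IsIdempotentElem e ∧ f = f * e ∧ g = g * (1 - e))
    (S : Submonoid A) : IdempotentsLiftAlong (algebraMap A (Localization S)) := by
  intro x hx
  obtain ⟨⟨a, s⟩, hs⟩ := IsLocalization.surj S x
  dsimp only at hs
  have h₀ : algebraMap A (Localization S) (a * (s - a)) = algebraMap A _ 0 := by
    rw [map_mul, map_sub, ← hs, map_zero]
    linear_combination -(algebraMap A (Localization S) s) ^ 2 * hx.eq
  obtain ⟨t, ht⟩ := (IsLocalization.eq_iff_exists S _).1 h₀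
  rw [mul_zero] at ht
  obtain ⟨e, he, hf, hg⟩ := h (t * a) (t * (s - a)) (by linear_combination (t : A) * ht)
  refine ⟨e, he, ?_⟩
  have hus := IsLocalization.map_units (Localization S) s
  have hut := IsLocalization.map_units (Localization S) t
  refine hus.mul_left_cancel (hut.mul_left_cancel ?_)
  have hf' := congrArg (algebraMap A (Localization S)) hf
  have hg' := congrArg (algebraMap A (Localization S)) hg
  simp only [map_mul, map_sub, map_one, ← hs] at hf' hg'
  linear_combination hg' - hf'

theorem isPurifiedRing_of_idempotentsLiftAlong {A : Type*} [CommRing A] [IsReduced A]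
    (h : ∀ S : Submonoid A, IdempotentsLiftAlong (algebraMap A (Localization S))) :
    IsPurifiedRing A := by
  intro p hp q hq hpq
  have hp' := hp.1.1
  have hq' := hq.1.1
  have hnle : ¬ p ≤ q := fun hle => hpq (Ideal.eq_of_le_minimalPrimes hq hp' hle)
  obtain ⟨x, hx, hxq⟩ := Set.not_subset.1 hnle
  obtain ⟨a, ha, hxa⟩ := Ideal.exists_notMem_mul_eq_zero_of_mem_minimalPrimes hp hx
  have haq : a ∈ q := (hq'.mem_or_mem (hxa ▸ q.zero_mem : x * a ∈ q)).resolve_left hxq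
  -- Since `x * a = 0`, the fraction `a / (a + x)` is idempotent. It is `1` modulo `p` and `0`
  -- modulo `q`, so `1 - e` separates the two for any lift `e`.
  let S := Submonoid.powers (a + x)
  let s : S := ⟨a + x, Submonoid.mem_powers _⟩
  have hmk : algebraMap A (Localization S) (a + x) * IsLocalization.mk' (Localization S) a s =
      algebraMap A _ a := IsLocalization.mk'_spec' (Localization S) a s
  have hu : IsUnit (algebraMap A (Localization S) (a + x)) := IsLocalization.map_units _ s
  have hxa' : algebraMap A (Localization S) x * algebraMap A _ a = 0 := by
    rw [← map_mul, hxa, map_zero]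
  obtain ⟨e, he, hmk'⟩ := h S (IsLocalization.mk' (Localization S) a s) (by
    refine hu.mul_left_cancel (hu.mul_left_cancel ?_)
    rw [map_add] at *
    generalize IsLocalization.mk' (Localization S) a s = y at *
    generalize algebraMap A (Localization S) x = x' at *
    generalize algebraMap A (Localization S) a = a' at *
    linear_combination ((a' + x') * y + a' - (a' + x')) * hmk - hxa')
  rw [← hmk', ← map_mul] at hmk
  obtain ⟨⟨_, n, rfl⟩, ht⟩ := (IsLocalization.eq_iff_exists S _).1 hmk
  have hz : (a + x) ^ n * ((a + x) * e - a) = 0 := by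
    linear_combination ht
  have hsp : a + x ∉ p := fun hm => ha ((Ideal.add_mem_iff_left _ hx).1 hm)
  have hsq : a + x ∉ q := fun hm => hxq ((Ideal.add_mem_iff_right _ haq).1 hm)
  have key : ∀ P : Ideal A, P.IsPrime → a + x ∉ P → (a + x) * e - a ∈ P := fun P hP hs =>
    (hP.mem_or_mem (hz ▸ P.zero_mem : (a + x) ^ n * ((a + x) * e - a) ∈ P)).resolve_left
      fun hm => hs (hP.mem_of_pow_mem _ hm)
  refine ⟨1 - e, he.one_sub, ?_, ?_⟩
  · refine (hp'.mem_or_mem (?_ : a * (1 - e) ∈ p)).resolve_left ha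
    have : a * (1 - e) = x * e - ((a + x) * e - a) := by ring
    rw [this]
    exact p.sub_mem (p.mul_mem_right _ hx) (key p hp' hsp)
  · rw [sub_sub_cancel]
    refine (hq'.mem_or_mem (?_ : (a + x) * e ∈ q)).resolve_left hsq
    have := q.add_mem (key q hq' hsq) haq
    rwa [sub_add_cancel] at this

/-! ### Mp-rings, pure ideals and max-regular ideals -/

theorem IsPurifiedRing.isMpRing {A : Type*} [CommRing A] (h : IsPurifiedRing A) : IsMpRing A := by
  intro P hP
  obtain ⟨p, hp, hpP⟩ := Ideal.exists_mem_minimalPrimes_le P hP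
  refine ⟨p, ⟨hp, hpP⟩, ?_⟩
  rintro q ⟨hq, hqP⟩
  by_contra hqp
  obtain ⟨e, -, he, he'⟩ := h q hq p hp hqp
  exact Ideal.not_mem_and_one_sub_mem hP (hqP he) (hpP he')

theorem Ideal.Pure.isRegularIdeal {A : Type*} [CommRing A]
    (h : ∀ f g : A, f * g = 0 → ∃ e : A, IsIdempotentElem e ∧ f = f * e ∧ g = g * (1 - e))
    {I : Ideal A} (hI : I.Pure) : IsRegularIdeal I := by
  refine .of_exists_eq_mul fun x hx => ?_
  obtain ⟨y, hy, hxy⟩ := Ideal.exists_eq_mul_of_pure hx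
  obtain ⟨e, he, hf, hg⟩ := h x (1 - y) (by linear_combination hxy)
  refine ⟨e, ?_, he, hf⟩
  have : e = e * y := by linear_combination hg
  rw [this]
  exact I.mul_mem_left _ hy

/-- For `x ∈ p`, no maximal ideal contains `Ann(x) + p`: above `p` there is no other minimal prime
below it, so `x` vanishes in the localization there. Hence `x = x * y` with `y ∈ p`. -/
theorem IsMpRing.pure_of_mem_minimalPrimes {A : Type*} [CommRing A] [IsReduced A]
    (h : IsMpRing A) {p : Ideal A} (hp : p ∈ minimalPrimes A) : p.Pure := by
  have key : ∀ x ∈ p, ∃ y ∈ p, x = x * y := by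
    intro x hx
    have htop : (Ideal.span {x}).annihilator ⊔ p = ⊤ := by
      by_contra hne
      obtain ⟨M, hM, hle⟩ := Ideal.exists_le_maximal _ hne
      have hpM : p ≤ M := le_sup_right.trans hle
      obtain ⟨y, hy, hxy⟩ := Ideal.exists_notMem_mul_eq_zero hM.isPrime fun q hq hqM =>
        (h M hM.isPrime).unique ⟨hq, hqM⟩ ⟨hp, hpM⟩ ▸ hx
      refine hy (hle (Ideal.mem_sup_left ?_))
      rwa [Submodule.mem_annihilator_span_singleton, smul_eq_mul, mul_comm]
    obtain ⟨a, ha, y, hy, hay⟩ := Submodule.mem_sup.1 ((Ideal.eq_top_iff_one _).1 htop)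
    rw [Submodule.mem_annihilator_span_singleton, smul_eq_mul] at ha
    exact ⟨y, hy, by linear_combination ha - x * hay⟩
  refine Ideal.Pure.of_inf_eq_mul p fun J _ => le_antisymm ?_ Ideal.mul_le_inf
  rintro x ⟨hxp, hxJ⟩
  obtain ⟨y, hy, hxy⟩ := key x hxp
  rw [hxy, mul_comm p J]
  exact Ideal.mul_mem_mul hxJ hy

/-- A max-regular ideal is the regular part of every prime above it. Applied to a prime `P` and a
minimal `p ≤ P`, this identifies `M` with `p`. -/
theorem setOf_isMaxRegularIdeal_eq_minimalPrimes {A : Type*} [CommRing A]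
    (h : ∀ p ∈ minimalPrimes A, IsRegularIdeal p) :
    {M : Ideal A | IsMaxRegularIdeal M} = minimalPrimes A := by
  have key : ∀ p ∈ minimalPrimes A, p.regularPart = p := fun p hp =>
    le_antisymm p.regularPart_le
      ((h p hp).le_regularPart hp.1.1 hp.1.1.ne_top p.regularPart_le)
  ext M
  constructor
  · intro hM
    obtain ⟨P, hP, hMP⟩ := Ideal.exists_le_maximal M hM.1.1
    obtain ⟨p, hp, hpP⟩ := Ideal.exists_mem_minimalPrimes_le P hP.isPrime
    have hpM := Ideal.isMaxRegularIdeal_regularPart hp.1.1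
    rw [key p hp] at hpM
    rwa [hM.eq_regularPart hP.isPrime hMP, ← hpM.eq_regularPart hP.isPrime hpP]
  · intro hM
    have := Ideal.isMaxRegularIdeal_regularPart hM.1.1
    rwa [key M hM] at this

/-! ### Connected components of the spectrum -/

theorem IsPurifiedRing.connectedComponent_eq_zeroLocus {A : Type*} [CommRing A]
    (h : IsPurifiedRing A) {p : Ideal A} (hp : p ∈ minimalPrimes A) {P : PrimeSpectrum A}
    (hpP : p ≤ P.asIdeal) : connectedComponent P = PrimeSpectrum.zeroLocus (p : Set A) := by
  apply Set.Subset.antisymm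
  · intro Q hQ
    obtain ⟨q, hq, hqQ⟩ := Ideal.exists_mem_minimalPrimes_le Q.asIdeal Q.isPrime
    by_cases hpq : p = q
    · exact hpq ▸ hqQ
    obtain ⟨e, he, hep, heq⟩ := h p hp q hq hpq
    have hcl : IsClopen (PrimeSpectrum.zeroLocus {e}) :=
      PrimeSpectrum.isClopen_iff_zeroLocus.2 ⟨e, he, rfl⟩
    have := hcl.connectedComponent_subset (x := P)
      ((PrimeSpectrum.mem_zeroLocus _ _).2 (Set.singleton_subset_iff.2 (hpP hep))) hQ
    rw [PrimeSpectrum.mem_zeroLocus, Set.singleton_subset_iff] at this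
    exact (Ideal.not_mem_and_one_sub_mem Q.isPrime this (hqQ heq)).elim
  · have hpr := hp.1.1
    refine IsPreconnected.subset_connectedComponent ?_ hpP
    exact ((PrimeSpectrum.isIrreducible_zeroLocus_iff_of_radical p hpr.isRadical).2
      hpr).isPreirreducible.isPreconnected

theorem IsPurifiedRing.range_connectedComponent {A : Type*} [CommRing A]
    (h : IsPurifiedRing A) :
    Set.range (connectedComponent : PrimeSpectrum A → Set (PrimeSpectrum A)) =
      {C | ∃ p ∈ minimalPrimes A, C = PrimeSpectrum.zeroLocus (p : Set A)} := by
  ext C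
  constructor
  · rintro ⟨P, rfl⟩
    obtain ⟨p, hp, hpP⟩ := Ideal.exists_mem_minimalPrimes_le P.asIdeal P.isPrime
    exact ⟨p, hp, h.connectedComponent_eq_zeroLocus hp hpP⟩
  · rintro ⟨p, hp, rfl⟩
    exact ⟨⟨p, hp.1.1⟩, h.connectedComponent_eq_zeroLocus hp le_rfl⟩

/-- The component of `p` must be `V(p)`, and it contains the connected set cut out by the regular
part of `p`. As that part is radical, it contains `p`. -/
theorem isRegularIdeal_of_range_connectedComponent {A : Type*} [CommRing A] [IsReduced A]
    (h : Set.range (connectedComponent : PrimeSpectrum A → Set (PrimeSpectrum A)) =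
      {C | ∃ p ∈ minimalPrimes A, C = PrimeSpectrum.zeroLocus (p : Set A)})
    {p : Ideal A} (hp : p ∈ minimalPrimes A) : IsRegularIdeal p := by
  let P : PrimeSpectrum A := ⟨p, hp.1.1⟩
  obtain ⟨q, hq, hPq⟩ : connectedComponent P ∈
      {C | ∃ p ∈ minimalPrimes A, C = PrimeSpectrum.zeroLocus (p : Set A)} := h ▸ ⟨P, rfl⟩
  have hmem : P ∈ PrimeSpectrum.zeroLocus (q : Set A) := hPq ▸ mem_connectedComponent
  obtain rfl : q = p := Ideal.eq_of_le_minimalPrimes hp hq.1.1 hmem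
  have hsub := (Ideal.isPreconnected_zeroLocus_regularPart P.isPrime).subset_connectedComponent
    (x := P) P.asIdeal.regularPart_le
  rw [hPq, PrimeSpectrum.zeroLocus_subset_zeroLocus_iff,
    q.isRegularIdeal_regularPart.isRadical.radical] at hsub
  rw [le_antisymm hsub q.regularPart_le]
  exact q.isRegularIdeal_regularPart

/-! ### The flat topology on `Min(A)` -/

/-- `Min(A)` with the topology induced by the flat topology of the prime spectrum. -/
def MinFlat (A : Type*) [CommRing A] : Type _ := minSpec A

instance MinFlat.instTopologicalSpace (A : Type*) [CommRing A] : TopologicalSpace (MinFlat A) :=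
  minFlatTopology A

/-- The minimal prime ideal attached to a point of `Min(A)`. -/
def MinFlat.asIdeal {A : Type*} [CommRing A] (p : MinFlat A) : Ideal A := p.1.asIdeal

theorem MinFlat.mem_minimalPrimes {A : Type*} [CommRing A] (p : MinFlat A) :
    p.asIdeal ∈ minimalPrimes A := p.2

theorem MinFlat.isPrime {A : Type*} [CommRing A] (p : MinFlat A) : p.asIdeal.IsPrime :=
  p.1.isPrime

theorem MinFlat.ext {A : Type*} [CommRing A] {p q : MinFlat A} (h : p.asIdeal = q.asIdeal) :
    p = q :=
  Subtype.ext (PrimeSpectrum.ext h)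

/-- The minimal primes containing a given element. -/
def MinFlat.locus {A : Type*} [CommRing A] (f : A) : Set (MinFlat A) := {p | f ∈ p.asIdeal}

theorem MinFlat.preimage_zeroLocus {A : Type*} [CommRing A] (f : A) :
    (Subtype.val ⁻¹' PrimeSpectrum.zeroLocus {f} : Set (minSpec A)) = MinFlat.locus f := by
  ext p
  exact Set.singleton_subset_iff

theorem MinFlat.eq_generateFrom (A : Type*) [CommRing A] :
    MinFlat.instTopologicalSpace A =
      TopologicalSpace.generateFrom (Set.range (MinFlat.locus (A := A))) := by
  refine induced_generateFrom_eq.trans (congrArg TopologicalSpace.generateFrom ?_)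
  ext U
  constructor
  · rintro ⟨_, ⟨f, rfl⟩, rfl⟩
    exact ⟨f, (MinFlat.preimage_zeroLocus f).symm⟩
  · rintro ⟨f, rfl⟩
    exact ⟨_, ⟨f, rfl⟩, MinFlat.preimage_zeroLocus f⟩

theorem MinFlat.isOpen_locus {A : Type*} [CommRing A] (f : A) : IsOpen (MinFlat.locus f) := by
  rw [MinFlat.eq_generateFrom]
  exact TopologicalSpace.isOpen_generateFrom_of_mem ⟨f, rfl⟩

theorem MinFlat.compl_locus {A : Type*} [CommRing A] {e : A} (he : IsIdempotentElem e) :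
    (MinFlat.locus e)ᶜ = MinFlat.locus (1 - e) := by
  ext p
  have h := Ideal.mem_or_one_sub_mem_of_isIdempotentElem p.isPrime he
  exact ⟨h.resolve_left, fun h₁ h₂ => Ideal.not_mem_and_one_sub_mem p.isPrime h₂ h₁⟩

theorem MinFlat.isClopen_locus {A : Type*} [CommRing A] {e : A} (he : IsIdempotentElem e) :
    IsClopen (MinFlat.locus e) := by
  refine ⟨⟨?_⟩, MinFlat.isOpen_locus e⟩
  rw [MinFlat.compl_locus he]
  exact MinFlat.isOpen_locus _

instance MinFlat.instCompactSpace (A : Type*) [CommRing A] : CompactSpace (MinFlat A) := by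
  refine compactSpace_generateFrom (MinFlat.eq_generateFrom A) fun P hP hcov => ?_
  by_contra! H
  -- By Alexander's subbasis theorem only covers by loci matter. Without a finite subcover, the
  -- products of the defining elements avoid `0`; a minimal prime avoiding all of them is uncovered.
  let S : Submonoid A := Submonoid.closure {f | MinFlat.locus f ∈ P}
  have hS : ∀ f ∈ S, ∃ Q ⊆ P, Q.Finite ∧ MinFlat.locus f ⊆ ⋃₀ Q := by
    intro f hf
    induction hf using Submonoid.closure_induction with
    | mem f hf => exact ⟨{MinFlat.locus f}, Set.singleton_subset_iff.2 hf, Set.finite_singleton _,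
        by simp⟩
    | one => exact ⟨∅, Set.empty_subset _, Set.finite_empty,
        fun p hp => (p.isPrime.ne_top ((Ideal.eq_top_iff_one _).2 hp)).elim⟩
    | mul f g _ _ hf hg =>
      obtain ⟨Q, hQ, hQf, hfQ⟩ := hf
      obtain ⟨R, hR, hRf, hgR⟩ := hg
      refine ⟨Q ∪ R, Set.union_subset hQ hR, hQf.union hRf, fun p hp => ?_⟩
      rw [Set.sUnion_union]
      exact (p.isPrime.mem_or_mem hp).imp (@hfQ p) (@hgR p)
  have hd : Disjoint ((⊥ : Ideal A) : Set A) (S : Set A) := by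
    rw [Set.disjoint_left]
    rintro z hz hz'
    obtain rfl : z = 0 := hz
    obtain ⟨Q, hQ, hQf, h⟩ := hS 0 hz'
    exact H Q hQ hQf (Set.eq_univ_of_univ_subset fun p _ => h p.asIdeal.zero_mem)
  obtain ⟨Q, hQ, -, hQd⟩ := Ideal.exists_le_prime_disjoint _ _ hd
  obtain ⟨q, hq, hqQ⟩ := Ideal.exists_mem_minimalPrimes_le Q hQ
  let x : MinFlat A := ⟨⟨q, hq.1.1⟩, hq⟩
  obtain ⟨U, hU, hxU⟩ := Set.mem_sUnion.1 (hcov ▸ Set.mem_univ x)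
  obtain ⟨f, rfl⟩ := hP hU
  exact Set.disjoint_left.1 hQd (hqQ hxU) (Submonoid.subset_closure hU)

theorem IsMpRing.exists_mem_one_sub_mem {A : Type*} [CommRing A] (h : IsMpRing A) {p q : Ideal A}
    (hp : p ∈ minimalPrimes A) (hq : q ∈ minimalPrimes A) (hpq : p ≠ q) :
    ∃ x ∈ p, 1 - x ∈ q := by
  have htop : p ⊔ q = ⊤ := by
    by_contra hne
    obtain ⟨M, hM, hle⟩ := Ideal.exists_le_maximal _ hne
    exact hpq ((h M hM.isPrime).unique ⟨hp, le_sup_left.trans hle⟩ ⟨hq, le_sup_right.trans hle⟩)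
  obtain ⟨x, hx, y, hy, hxy⟩ := Submodule.mem_sup.1 ((Ideal.eq_top_iff_one _).1 htop)
  exact ⟨x, hx, by rwa [← hxy, add_sub_cancel_left]⟩

theorem IsMpRing.t2Space_minFlat {A : Type*} [CommRing A] (h : IsMpRing A) :
    T2Space (MinFlat A) := by
  refine ⟨fun p q hpq => ?_⟩
  obtain ⟨x, hx, hx'⟩ := h.exists_mem_one_sub_mem p.mem_minimalPrimes q.mem_minimalPrimes
    fun heq => hpq (MinFlat.ext heq)
  exact ⟨_, _, MinFlat.isOpen_locus x, MinFlat.isOpen_locus (1 - x), hx, hx',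
    Set.disjoint_left.2 fun r => Ideal.not_mem_and_one_sub_mem r.isPrime⟩

/-- In an mp-ring, a prime containing the intersection of a compact family of minimal primes
contains a member of the family. -/
theorem IsMpRing.exists_asIdeal_le {A : Type*} [CommRing A] (h : IsMpRing A) {U : Set (MinFlat A)}
    (hU : IsCompact U) {P : Ideal A} (hP : P.IsPrime) (hle : ⨅ p ∈ U, p.asIdeal ≤ P) :
    ∃ p ∈ U, p.asIdeal ≤ P := by
  by_contra! H
  obtain ⟨m, hm, hmP⟩ := Ideal.exists_mem_minimalPrimes_le P hP
  have key : ∀ p : U, ∃ x ∈ p.1.asIdeal, 1 - x ∈ m := fun p =>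
    h.exists_mem_one_sub_mem p.1.mem_minimalPrimes hm fun heq => H p.1 p.2 (heq ▸ hmP)
  choose x hx hxm using key
  obtain ⟨t, ht⟩ := hU.elim_finite_subcover (fun p => MinFlat.locus (x p))
    (fun p => MinFlat.isOpen_locus _) fun p hp => Set.mem_iUnion.2 ⟨⟨p, hp⟩, hx ⟨p, hp⟩⟩
  have hprod : ∏ p ∈ t, x p ∈ P := by
    refine hle ?_
    simp only [Submodule.mem_iInf]
    intro p hp
    obtain ⟨q, hq, hpq⟩ := Set.mem_iUnion₂.1 (ht hp)
    exact Ideal.mem_of_dvd _ (Finset.dvd_prod_of_mem x hq) hpq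
  obtain ⟨p, -, hp⟩ := (hP.prod_mem_iff).1 hprod
  exact Ideal.not_mem_and_one_sub_mem hP hp (hmP (hxm p))

theorem IsMpRing.isPurifiedRing {A : Type*} [CommRing A] [IsReduced A] (h : IsMpRing A)
    [TotallyDisconnectedSpace (MinFlat A)] : IsPurifiedRing A := by
  have := h.t2Space_minFlat
  intro p hp q hq hpq
  let x : MinFlat A := ⟨⟨p, hp.1.1⟩, hp⟩
  let y : MinFlat A := ⟨⟨q, hq.1.1⟩, hq⟩
  have hxy : x ∈ ({y}ᶜ : Set (MinFlat A)) := fun heq => hpq (congrArg MinFlat.asIdeal heq)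
  obtain ⟨U, hU, hxU, hUy⟩ := compact_exists_isClopen_in_isOpen isOpen_compl_singleton hxy
  have hyU : y ∈ Uᶜ := fun hy => hUy hy rfl
  -- A maximal ideal containing both intersections would contain a minimal prime from `U` and one
  -- from its complement, against the mp property.
  have htop : (⨅ p ∈ U, p.asIdeal) ⊔ (⨅ p ∈ Uᶜ, p.asIdeal) = ⊤ := by
    by_contra hne
    obtain ⟨M, hM, hle⟩ := Ideal.exists_le_maximal _ hne
    obtain ⟨a, haU, ha⟩ := h.exists_asIdeal_le hU.isClosed.isCompact hM.isPrime
      (le_sup_left.trans hle)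
    obtain ⟨b, hbU, hb⟩ := h.exists_asIdeal_le hU.compl.isClosed.isCompact hM.isPrime
      (le_sup_right.trans hle)
    have : a = b := MinFlat.ext ((h M hM.isPrime).unique ⟨a.mem_minimalPrimes, ha⟩
      ⟨b.mem_minimalPrimes, hb⟩)
    exact hbU (this ▸ haU)
  obtain ⟨e, he, f, hf, hef⟩ := Submodule.mem_sup.1 ((Ideal.eq_top_iff_one _).1 htop)
  obtain rfl : f = 1 - e := by linear_combination hef
  simp only [Submodule.mem_iInf] at he hf
  refine ⟨e, ?_, he x hxU, hf y hyU⟩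
  -- Every minimal prime contains `e` or `1 - e`, so the product is nilpotent, hence zero.
  have hz : e * (1 - e) ∈ sInf (minimalPrimes A) := by
    refine Ideal.mem_sInf.2 fun {r} hr => ?_
    let z : MinFlat A := ⟨⟨r, hr.1.1⟩, hr⟩
    by_cases hzU : z ∈ U
    · exact r.mul_mem_right _ (he z hzU)
    · exact r.mul_mem_left _ (hf z hzU)
  have hz' : e * (1 - e) = 0 := by
    have := Ideal.sInf_minimalPrimes (I := (⊥ : Ideal A))
    rw [show sInf (minimalPrimes A) = (⊥ : Ideal A).radical from this] at hz
    obtain ⟨n, hn⟩ := hz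
    exact eq_zero_of_pow_eq_zero hn
  change e * e = e
  linear_combination -hz'

theorem IsPurifiedRing.totallyDisconnectedSpace_minFlat {A : Type*} [CommRing A]
    (h : IsPurifiedRing A) : TotallyDisconnectedSpace (MinFlat A) := by
  refine totallyDisconnectedSpace_iff_connectedComponent_subsingleton.2 fun p r hr q hq => ?_
  have key : ∀ q ∈ connectedComponent p, q = p := by
    intro q hq
    by_contra hqp
    obtain ⟨e, he, hep, heq⟩ := h _ p.mem_minimalPrimes _ q.mem_minimalPrimes
      fun heq => hqp (MinFlat.ext heq.symm)
    exact Ideal.not_mem_and_one_sub_mem q.isPrime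
      ((MinFlat.isClopen_locus he).connectedComponent_subset hep hq) heq
  rw [key r hr, key q hq]

theorem isTopologicalBasis_idempotent_locus {A : Type*} [CommRing A]
    (h : ∀ p ∈ minimalPrimes A, IsRegularIdeal p) :
    TopologicalSpace.IsTopologicalBasis
      {U : Set (MinFlat A) | ∃ e : A, IsIdempotentElem e ∧ U = MinFlat.locus e} := by
  refine ⟨?_, ?_, ?_⟩
  · rintro _ ⟨e, he, rfl⟩ _ ⟨f, hf, rfl⟩ p ⟨hpe, hpf⟩
    refine ⟨_, ⟨e + f - e * f, he.add_sub_mul_self hf, rfl⟩, p.asIdeal.sub_mem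
      (p.asIdeal.add_mem hpe hpf) (p.asIdeal.mul_mem_left _ hpf), fun q hq => ⟨?_, ?_⟩⟩
    · have : e = e * (e + f - e * f) := by linear_combination (f - 1) * he.eq
      exact (congrArg (· ∈ q.asIdeal) this).mpr (q.asIdeal.mul_mem_left _ hq)
    · have : f = f * (e + f - e * f) := by linear_combination (e - 1) * hf.eq
      exact (congrArg (· ∈ q.asIdeal) this).mpr (q.asIdeal.mul_mem_left _ hq)
  · exact Set.eq_univ_of_univ_subset fun p _ => ⟨_, ⟨0, .zero, rfl⟩, p.asIdeal.zero_mem⟩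
  · refine le_antisymm (le_generateFrom ?_) ?_
    · rintro _ ⟨e, -, rfl⟩
      exact MinFlat.isOpen_locus e
    · rw [MinFlat.eq_generateFrom]
      refine le_generateFrom ?_
      rintro _ ⟨f, rfl⟩
      let := TopologicalSpace.generateFrom
        {U : Set (MinFlat A) | ∃ e : A, IsIdempotentElem e ∧ U = MinFlat.locus e}
      refine isOpen_iff_forall_mem_open.2 fun p hp => ?_
      obtain ⟨e, he, hei, hfe⟩ := (h _ p.mem_minimalPrimes).exists_eq_mul hp
      refine ⟨_, fun q hq => ?_, TopologicalSpace.isOpen_generateFrom_of_mem ⟨e, hei, rfl⟩, he⟩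
      exact (congrArg (· ∈ q.asIdeal) hfe).mpr (q.asIdeal.mul_mem_left _ hq)

theorem isPurifiedRing_of_isTopologicalBasis {A : Type*} [CommRing A]
    (h : TopologicalSpace.IsTopologicalBasis
      {U : Set (MinFlat A) | ∃ e : A, IsIdempotentElem e ∧ U = MinFlat.locus e}) :
    IsPurifiedRing A := by
  intro p hp q hq hpq
  let x : MinFlat A := ⟨⟨p, hp.1.1⟩, hp⟩
  let y : MinFlat A := ⟨⟨q, hq.1.1⟩, hq⟩
  have hnle : ¬ p ≤ q := fun hle => hpq (Ideal.eq_of_le_minimalPrimes hq hp.1.1 hle)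
  obtain ⟨f, hf, hfq⟩ := Set.not_subset.1 hnle
  obtain ⟨_, ⟨e, he, rfl⟩, hxe, hef⟩ :=
    h.exists_subset_of_mem_open (show x ∈ MinFlat.locus f from hf) (MinFlat.isOpen_locus f)
  exact ⟨e, he, hxe, (Ideal.mem_or_one_sub_mem_of_isIdempotentElem hq.1.1 he).resolve_left
    fun hm => hfq (hef (show y ∈ MinFlat.locus e from hm))⟩

theorem mainTheorem2 (A : Type*) [CommRing A] [IsReduced A] :
    List.TFAE [
      -- (i)
      IsPurifiedRing A,
      -- (ii), with the topology on `Min(A)` induced by the flat topology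
      IsMpRing A ∧ @TotallyDisconnectedSpace (minSpec A) (minFlatTopology A),
      -- (iii)
      ∀ p ∈ minimalPrimes A, IsRegularIdeal p,
      -- (iv), with the Zariski topology on the prime spectrum
      Set.range (connectedComponent : PrimeSpectrum A → Set (PrimeSpectrum A)) =
        {C | ∃ p ∈ minimalPrimes A, C = PrimeSpectrum.zeroLocus (p : Set A)},
      -- (v)
      ∀ (n d : ℕ) (f : Fin d → MvPolynomial (Fin n) A),
        (∀ p ∈ minimalPrimes A, SystemHasSolution f (A ⧸ p)) → SystemHasSolution f A,
      -- (vi)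
      ∀ S : Submonoid A, IdempotentsLiftAlong (algebraMap A (Localization S)),
      -- (vii), with the topology on `Min(A)` induced by the flat topology
      @TopologicalSpace.IsTopologicalBasis (minSpec A) (minFlatTopology A)
        {U | ∃ e : A, IsIdempotentElem e ∧ U = Subtype.val ⁻¹' PrimeSpectrum.zeroLocus {e}},
      -- (viii)
      IsMpRing A ∧ ∀ I : Ideal A, I.Pure → IsRegularIdeal I,
      -- (ix)
      {M : Ideal A | IsMaxRegularIdeal M} = minimalPrimes A,
      -- (x)
      ∀ f : A, IsRegularIdeal (Ideal.span {f}).annihilator,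
      -- (xi)
      ∀ f g : A, f * g = 0 →
        ∃ e : A, IsIdempotentElem e ∧ f = f * e ∧ g = g * (1 - e)] := by
  have hbasis : {U : Set (minSpec A) | ∃ e : A, IsIdempotentElem e ∧
      U = Subtype.val ⁻¹' PrimeSpectrum.zeroLocus {e}} =
      {U : Set (MinFlat A) | ∃ e : A, IsIdempotentElem e ∧ U = MinFlat.locus e} := by
    simp only [MinFlat.preimage_zeroLocus]
    rfl
  rw [hbasis]
  tfae_have 1 → 3 := fun h _ hp => h.isRegularIdeal hp
  tfae_have 3 → 1 := isPurifiedRing_of_isRegularIdeal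
  tfae_have 3 → 5 := fun h _ _ => systemHasSolution_of_forall_minimalPrimes h
  tfae_have 5 → 11 := exists_isIdempotentElem_of_systemHasSolution
  tfae_have 11 → 10 := isRegularIdeal_annihilator
  tfae_have 10 → 3 := fun h _ hp => isRegularIdeal_of_annihilator h hp
  tfae_have 11 → 6 := idempotentsLiftAlong_localization
  tfae_have 6 → 1 := isPurifiedRing_of_idempotentsLiftAlong
  tfae_have 1 → 2 := fun h => ⟨h.isMpRing, h.totallyDisconnectedSpace_minFlat⟩
  tfae_have 2 → 1 := fun ⟨h, _⟩ =>
    have : TotallyDisconnectedSpace (MinFlat A) := by assumption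
    h.isPurifiedRing
  tfae_have 3 → 7 := isTopologicalBasis_idempotent_locus
  tfae_have 7 → 1 := isPurifiedRing_of_isTopologicalBasis
  tfae_have 1 → 4 := IsPurifiedRing.range_connectedComponent
  tfae_have 4 → 3 := fun h _ hp => isRegularIdeal_of_range_connectedComponent h hp
  tfae_have 3 → 9 := setOf_isMaxRegularIdeal_eq_minimalPrimes
  tfae_have 9 → 3 := fun h _ hp => (h ▸ hp : _ ∈ {M : Ideal A | IsMaxRegularIdeal M}).1.2
  tfae_have 8 → 3 := fun h _ hp => h.2 _ (h.1.pure_of_mem_minimalPrimes hp)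
  tfae_have 1 → 8 := fun h => ⟨h.isMpRing, fun _ hI =>
    hI.isRegularIdeal (tfae_5_to_11 (tfae_3_to_5 (tfae_1_to_3 h)))⟩
  tfae_finish
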